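/- Let $q>1$ and $n\ge 2$ be integers ($q$ not necessarily a prime power). A quantum code $[[n,k,d]]_q$ is a subspace $\mathcal C\subseteq(\mathbb C^q)^{\otimes n}$ of dimension $q^k$ with minimum distance $d$. Here the minimum distance is the largest $d$ such that every linear operator $E$ on $(\mathbb C^q)^{\otimes n}$ acting as the identity on all but fewer than $d$ of the tensor factors is detected by $\mathcal C$, i.e. there is a scalar $c_E$ with $\langle u,Ev\rangle=c_E\langle u,v\rangle$ for all $u,v\in\mathcal C$; if $\dim\mathcal C=1$, it is required in addition, as usual, that $c_E=q^{-n}\operatorname{tr}E$. The code is called quantum MDS if equality holds in the quantum Singleton bound $n+2\ge k+2d$. Then quantum MDS codes $[[n,n-2,2]]_q$ exist for every even $n\ge 2$. If $q$ is odd or divisible by $4$, they exist for every $n\ge 2$. -/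

import Mathlib

namespace QuantumCode

/-- The Hilbert space `(ℂ^q)^{⊗ n}` of `n` qudits of dimension `q`, written in the orthonormal
computational basis `|x₁ … xₙ⟩`, `x ∈ {0, …, q - 1}ⁿ`. -/
abbrev Qudits (n q : ℕ) : Type := EuclideanSpace ℂ (Fin n → Fin q)

/-- Linear operators on `n` qudits, as matrices in the computational basis. -/
abbrev Operator (n q : ℕ) : Type := Matrix (Fin n → Fin q) (Fin n → Fin q) ℂ

/-- `A` acts as the identity on all qudits outside `S`, that is, `A = B ⊗ 1` for some operator `B`
on the qudits in `S`. -/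
def ActsOnlyOn {n q : ℕ} (A : Operator n q) (S : Finset (Fin n)) : Prop :=
  ∃ B : Matrix (S → Fin q) (S → Fin q) ℂ, ∀ x y : Fin n → Fin q,
    ((∀ i, i ∉ S → x i = y i) → A x y = B (fun i => x i) (fun i => y i)) ∧
    (¬ (∀ i, i ∉ S → x i = y i) → A x y = 0)

/-- The Knill–Laflamme condition for detecting the error `A`: the compression of `A` to the code
is a scalar. -/
def Detects {n q : ℕ} (C : Submodule ℂ (Qudits n q)) (A : Operator n q) : Prop :=
  ∃ c : ℂ, ∀ u ∈ C, ∀ v ∈ C,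
    inner ℂ u (Matrix.toEuclideanLin A v) = c * inner ℂ u v

/-- `A` is purely detected: the scalar is the normalized trace of `A`, so the code does not
distinguish `A` from its scalar part. -/
def PurelyDetects {n q : ℕ} (C : Submodule ℂ (Qudits n q)) (A : Operator n q) : Prop :=
  ∀ u ∈ C, ∀ v ∈ C,
    inner ℂ u (Matrix.toEuclideanLin A v) = (A.trace / (q : ℂ) ^ n) * inner ℂ u v

/-- The minimum distance of `C` is at least `d`: every error that affects fewer than `d` qudits is
detected. For one-dimensional codes this condition is void, and by the usual convention the
errors have to be purely detected. -/
def DistanceAtLeast {n q : ℕ} (C : Submodule ℂ (Qudits n q)) (d : ℕ) : Prop :=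
  ∀ (S : Finset (Fin n)) (A : Operator n q), S.card < d → ActsOnlyOn A S →
    Detects C A ∧ (Module.finrank ℂ C = 1 → PurelyDetects C A)

/-- `C` is a quantum code `[[n, k, d]]_q`: a subspace of dimension `q ^ k` whose minimum distance
is exactly `d`. -/
def IsCode {n q : ℕ} (C : Submodule ℂ (Qudits n q)) (k d : ℕ) : Prop :=
  Module.finrank ℂ C = q ^ k ∧ IsGreatest {e : ℕ | DistanceAtLeast C e} d

/-- `C` is a quantum MDS code `[[n, k, d]]_q`: equality holds in the quantum Singleton bound
`n + 2 ≥ k + 2 d`. -/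
def IsMDSCode {n q : ℕ} (C : Submodule ℂ (Qudits n q)) (k d : ℕ) : Prop :=
  IsCode C k d ∧ n + 2 = k + 2 * d

end QuantumCode

/-!
Let `G` be an abelian group of order `q` with automorphisms `a₁, …, aₙ` whose sum is zero, and label
the levels of a qudit by `G`. The words `(a₁ t, …, aₙ t)` form a subgroup `D` of the group `E` of
words with sum zero, and `[E : D] = q ^ (n - 2)`. The code consists of the states supported on `E`
and constant on the cosets of `D`. A nonzero word of weight one is not in `E`, so only the diagonal
part of an error on one qudit acts on the code; as `D` takes every value in that coordinate,
averaging over translations replaces this diagonal part by its mean. Conversely, the shift by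
`(g, -g, 0, …, 0) ∈ E` fixes the uniform state on `E`, and for `n ≥ 3` it moves the uniform state on
`D` to an orthogonal one, while for `n = 2` it is not purely detected because its trace is zero.

The sum of automorphisms vanishes for `1, -1, 1, -1, …`, and for `1, u, -(1 + u), 1, -1, …` if `u`
and `1 + u` are units of a ring structure on `G`. If `q = 2 ^ k * m` with `m` odd and `k ≠ 1`, such
units exist in `𝔽_{2 ^ k} × ℤ / m`, and already `u = 1` works in `ℤ / m` when `k = 0`.
-/

namespace QuantumCode

section Averaging

variable {X M : Type*} [AddCommGroup X] [Fintype X] [CommSemiring M]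

lemma card_mul_sum_mul_of_codisjoint {D H : AddSubgroup X} (hDH : Codisjoint D H) {F g : X → M}
    (hF : ∀ d ∈ D, ∀ x, F (x + d) = F x) (hg : ∀ h ∈ H, ∀ x, g (x + h) = g x) :
    (Fintype.card X : M) * ∑ x, g x * F x = (∑ x, g x) * ∑ x, F x := by
  -- `g` does not distinguish `w` from its component in `D`, and that component preserves `F`.
  have translate_left (w : X) : ∑ x, g (x + w) * F x = ∑ x, g x * F x := by
    obtain ⟨d, hd, h, hh, rfl⟩ := AddSubgroup.mem_sup.1 (hDH.eq_top ▸ AddSubgroup.mem_top w)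
    calc ∑ x, g (x + (d + h)) * F x = ∑ x, g (x + d) * F (x + d) :=
          Finset.sum_congr rfl fun x _ => by rw [← add_assoc, hg h hh, hF d hd]
      _ = ∑ x, g x * F x := Equiv.sum_comp (Equiv.addRight d) fun x => g x * F x
  calc (Fintype.card X : M) * ∑ x, g x * F x = ∑ w, ∑ x, g (x + w) * F x := by
        simp only [translate_left, Finset.sum_const, Finset.card_univ, nsmul_eq_mul]
    _ = ∑ x, (∑ w, g (x + w)) * F x := by rw [Finset.sum_comm]; simp only [Finset.sum_mul]
    _ = (∑ x, g x) * ∑ x, F x := by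
        rw [Finset.mul_sum]
        exact Finset.sum_congr rfl fun x _ => by rw [← Equiv.sum_comp (Equiv.addLeft x) g]; rfl

end Averaging

section CSSCode

variable {G : Type*} {n q : ℕ} {ι : Type*}

/-- The words over the group `G` that label the computational basis, when the levels of a qudit
are identified with the elements of `G` along `e`. -/
def word (e : Fin q ≃ G) : (ι → Fin q) ≃ (ι → G) :=
  Equiv.piCongrRight fun _ => e

@[simp]
lemma word_apply (e : Fin q ≃ G) (x : ι → Fin q) (i : ι) : word e x i = e (x i) := rfl

variable [AddCommGroup G]

/-- The words over `G` whose letters in the positions `S` are zero. -/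
def vanishingOn (S : Set ι) : AddSubgroup (ι → G) :=
  AddSubgroup.pi S fun _ => ⊥

@[simp]
lemma mem_vanishingOn {S : Set ι} {v : ι → G} : v ∈ vanishingOn S ↔ ∀ i ∈ S, v i = 0 := Iff.rfl

lemma vanishingOn_anti : Antitone (vanishingOn : Set ι → AddSubgroup (ι → G)) :=
  fun _ _ hST _ hv i hi => hv i (hST hi)

/-- The Calderbank–Shor–Steane code of two additive codes `D ≤ E` over the group `G`: the states
that are supported on the words of `E` and constant on the cosets of `D`. The inclusion is not
part of the definition. -/
def cssCode (e : Fin q ≃ G) (D E : AddSubgroup (Fin n → G)) : Submodule ℂ (Qudits n q) where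
  carrier := {f | (∀ x, word e x ∉ E → f x = 0) ∧ ∀ x y, -word e x + word e y ∈ D → f x = f y}
  zero_mem' := by simp
  add_mem' := by
    rintro f g ⟨hfE, hfD⟩ ⟨hgE, hgD⟩
    exact ⟨fun x hx => by simp [hfE x hx, hgE x hx],
      fun x y hxy => by simp [hfD x y hxy, hgD x y hxy]⟩
  smul_mem' := by
    rintro c f ⟨hfE, hfD⟩
    exact ⟨fun x hx => by simp [hfE x hx], fun x y hxy => by simp [hfD x y hxy]⟩

variable {e : Fin q ≃ G} {D E : AddSubgroup (Fin n → G)}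

open Classical in
/-- States of the code of `D ≤ E` as functions on the quotient `E ⧸ D`. -/
noncomputable def cssCodeEquiv (e : Fin q ≃ G) (hDE : D ≤ E) :
    cssCode e D E ≃ₗ[ℂ] (E ⧸ D.addSubgroupOf E → ℂ) where
  toFun f c := f.1 ((word e).symm c.out)
  map_add' _ _ := rfl
  map_smul' _ _ := rfl
  invFun φ := ⟨WithLp.toLp 2 fun x =>
      if hx : word e x ∈ E then φ (QuotientAddGroup.mk ⟨word e x, hx⟩) else 0, by
    refine ⟨fun x hx => dif_neg hx, fun x y hxy => ?_⟩
    have mem_iff : word e x ∈ E ↔ word e y ∈ E := by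
      rw [← add_neg_cancel_left (word e x) (word e y), E.add_mem_cancel_right (hDE hxy)]
    by_cases hx : word e x ∈ E
    · simp only [dif_pos hx, dif_pos (mem_iff.1 hx)]
      exact congrArg φ (QuotientAddGroup.eq.2 hxy)
    · simp only [dif_neg hx, dif_neg (mt mem_iff.2 hx)]⟩
  left_inv := by
    rintro ⟨f, hfE, hfD⟩
    ext x
    by_cases hx : word e x ∈ E
    · simp only [dif_pos hx]
      refine hfD _ _ ?_
      rw [Equiv.apply_symm_apply]
      exact QuotientAddGroup.eq (s := D.addSubgroupOf E).1 (QuotientAddGroup.out_eq' _)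
    · simp only [dif_neg hx, hfE x hx]
  right_inv φ := by
    ext c
    simp

lemma finrank_cssCode (e : Fin q ≃ G) (hDE : D ≤ E) :
    Module.finrank ℂ (cssCode e D E) = D.relIndex E := by
  have : Finite G := Finite.of_equiv _ e
  have := Fintype.ofFinite (E ⧸ D.addSubgroupOf E)
  rw [(cssCodeEquiv e hDE).finrank_eq, Module.finrank_fintype_fun_eq_card,
    ← Nat.card_eq_fintype_card]
  rfl

lemma inner_toEuclideanLin (A : Operator n q) (u v : Qudits n q) :
    inner ℂ u (Matrix.toEuclideanLin A v) = ∑ x, ∑ y, A x y * (v y * star (u x)) := by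
  simp only [EuclideanSpace.inner_eq_star_dotProduct, Matrix.toLpLin_apply, Matrix.mulVec,
    dotProduct, Finset.sum_mul, mul_assoc, Pi.star_apply]

lemma diag_eq_of_actsOnlyOn {A : Operator n q} {S : Finset (Fin n)} (hA : ActsOnlyOn A S)
    {x y : Fin n → Fin q} (hxy : ∀ i ∈ S, x i = y i) : A x x = A y y := by
  obtain ⟨B, hB⟩ := hA
  have : (fun i : S => x i) = fun i : S => y i := funext fun i => hxy i i.2
  rw [(hB x x).1 fun _ _ => rfl, (hB y y).1 fun _ _ => rfl, this]

/-- Two words of `E` that agree outside `S` are equal. -/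
lemma inner_toEuclideanLin_of_disjoint {A : Operator n q} {S : Finset (Fin n)}
    (hA : ActsOnlyOn A S) (hE : Disjoint E (vanishingOn (S : Set (Fin n))ᶜ)) {u v : Qudits n q}
    (hu : u ∈ cssCode e D E) (hv : v ∈ cssCode e D E) :
    inner ℂ u (Matrix.toEuclideanLin A v) = ∑ x, A x x * (v x * star (u x)) := by
  obtain ⟨B, hB⟩ := hA
  rw [inner_toEuclideanLin]
  refine Finset.sum_congr rfl fun x _ => Fintype.sum_eq_single x fun y hyx => ?_
  by_cases hx : word e x ∈ E
  · by_cases hy : word e y ∈ E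
    · rw [(hB x y).2, zero_mul]
      intro h_agree
      refine hyx ((word e).injective (sub_eq_zero.1 ?_))
      refine AddSubgroup.disjoint_def.1 hE (E.sub_mem hy hx) fun i hi => ?_
      simp [h_agree i (by simpa using hi)]
    · simp [hv.1 y hy]
  · simp [hu.1 x hx]

lemma apply_word_symm_add {f : Qudits n q} (hf : f ∈ cssCode e D E) {d : Fin n → G} (hd : d ∈ D)
    (w : Fin n → G) : f ((word e).symm (w + d)) = f ((word e).symm w) :=
  (hf.2 _ _ (by simpa using hd)).symm

lemma purelyDetects_cssCode {A : Operator n q} {S : Finset (Fin n)} (hA : ActsOnlyOn A S)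
    (hE : Disjoint E (vanishingOn (S : Set (Fin n))ᶜ))
    (hD : Codisjoint D (vanishingOn (S : Set (Fin n)))) :
    PurelyDetects (cssCode e D E) A := by
  have : Fintype G := Fintype.ofEquiv _ e
  intro u hu v hv
  have card_words : Fintype.card (Fin n → G) = q ^ n := by
    rw [← Fintype.card_congr (word e), Fintype.card_fun, Fintype.card_fin, Fintype.card_fin]
  have card_ne_zero : (q : ℂ) ^ n ≠ 0 := by
    rw [← Nat.cast_pow, ← card_words]
    exact Nat.cast_ne_zero.2 Fintype.card_ne_zero
  have average : (q : ℂ) ^ n * ∑ x, A x x * (v x * star (u x)) =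
      A.trace * ∑ x, v x * star (u x) := by
    have on_words := card_mul_sum_mul_of_codisjoint hD
      (F := fun w => v ((word e).symm w) * star (u ((word e).symm w)))
      (g := fun w => A ((word e).symm w) ((word e).symm w))
      (fun d hd w => by simp only [apply_word_symm_add hu hd, apply_word_symm_add hv hd])
      (fun h hh w => diag_eq_of_actsOnlyOn hA fun i hi => congrArg e.symm (by
        simp [mem_vanishingOn.1 hh i hi]))
    simpa only [Matrix.trace, Matrix.diag_apply, card_words, Nat.cast_pow,
      Equiv.sum_comp (word e).symm fun x => A x x * (v x * star (u x)),
      Equiv.sum_comp (word e).symm fun x => A x x,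
      Equiv.sum_comp (word e).symm fun x => v x * star (u x)] using on_words
  rw [inner_toEuclideanLin_of_disjoint hA hE hu hv, div_mul_eq_mul_div, eq_div_iff card_ne_zero,
    mul_comm, average, EuclideanSpace.inner_eq_star_dotProduct]
  rfl

/-- The permutation of basis labels that adds `s` to the corresponding words. -/
def translate (e : Fin q ≃ G) (s : ι → G) : Equiv.Perm (ι → Fin q) :=
  (word e).symm.permCongr (Equiv.addRight s)

@[simp]
lemma word_translate (e : Fin q ≃ G) (s : ι → G) (x : ι → Fin q) :
    word e (translate e s x) = word e x + s := by
  simp [translate]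

lemma translate_apply (e : Fin q ≃ G) (s : ι → G) (x : ι → Fin q) (i : ι) :
    translate e s x i = e.symm (e (x i) + s i) := rfl

/-- The analogue of a Pauli `X` error: the operator taking `f` to `x ↦ f (x + s)`, hence the
basis state of a word `w` to that of `w - s`. -/
def shiftOperator (e : Fin q ≃ G) (s : Fin n → G) : Operator n q :=
  (translate e s).permMatrix ℂ

lemma toEuclideanLin_shiftOperator_apply (e : Fin q ≃ G) (s : Fin n → G) (f : Qudits n q)
    (x : Fin n → Fin q) :
    Matrix.toEuclideanLin (shiftOperator e s) f x = f (translate e s x) := by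
  rw [Matrix.toLpLin_apply, shiftOperator, Matrix.permMatrix_mulVec]
  rfl

lemma trace_shiftOperator (e : Fin q ≃ G) {s : Fin n → G} (hs : s ≠ 0) :
    (shiftOperator e s).trace = 0 := by
  have : Function.fixedPoints (translate e s) = ∅ := by
    refine Set.eq_empty_of_forall_notMem fun x hx => hs ?_
    simpa using (word_translate e s x).symm.trans (congrArg (word e) hx)
  rw [shiftOperator, Matrix.trace_permutation, this, Set.ncard_empty, Nat.cast_zero]

lemma actsOnlyOn_shiftOperator (e : Fin q ≃ G) {s : Fin n → G} {S : Finset (Fin n)}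
    (hs : s ∈ vanishingOn (S : Set (Fin n))ᶜ) : ActsOnlyOn (shiftOperator e s) S := by
  have outside (x : Fin n → Fin q) {i : Fin n} (hi : i ∉ S) : translate e s x i = x i := by
    rw [translate_apply, hs i (by simpa using hi), add_zero, e.symm_apply_apply]
  refine ⟨(translate e fun i : S => s i).permMatrix ℂ, fun x y => ⟨fun hxy => ?_, fun hxy => ?_⟩⟩
  · have : translate e s x = y ↔
        translate e (fun i : S => s i) (fun i => x i) = fun i : S => y i := by
      refine ⟨fun h => funext fun i => congrFun h i, fun h => funext fun i => ?_⟩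
      by_cases hi : i ∈ S
      · exact congrFun h ⟨i, hi⟩
      · rw [outside x hi, hxy i hi]
    simp [shiftOperator, PEquiv.toMatrix_apply, this]
  · have : translate e s x ≠ y := by
      rintro rfl
      exact hxy fun i hi => (outside x hi).symm
    simp [shiftOperator, PEquiv.toMatrix_apply, this]

/-- The unnormalized uniform superposition of the words in `H`. -/
noncomputable def uniformState (e : Fin q ≃ G) (H : AddSubgroup (Fin n → G)) : Qudits n q :=
  WithLp.toLp 2 fun x => (H : Set (Fin n → G)).indicator 1 (word e x)

section UniformState

variable {H : AddSubgroup (Fin n → G)} {x : Fin n → Fin q}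

lemma uniformState_of_mem (hx : word e x ∈ H) : uniformState e H x = 1 :=
  Set.indicator_of_mem hx _

lemma uniformState_of_notMem (hx : word e x ∉ H) : uniformState e H x = 0 :=
  Set.indicator_of_notMem hx _

lemma uniformState_eq_of_mem_iff {y : Fin n → Fin q} (h : word e x ∈ H ↔ word e y ∈ H) :
    uniformState e H x = uniformState e H y := by
  by_cases hx : word e x ∈ H
  · rw [uniformState_of_mem hx, uniformState_of_mem (h.1 hx)]
  · rw [uniformState_of_notMem hx, uniformState_of_notMem (mt h.2 hx)]

lemma uniformState_mem_cssCode (hDH : D ≤ H) (hHE : H ≤ E) :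
    uniformState e H ∈ cssCode e D E := by
  refine ⟨fun x hx => uniformState_of_notMem fun hxH => hx (hHE hxH), fun x y hxy => ?_⟩
  refine uniformState_eq_of_mem_iff ?_
  rw [← add_neg_cancel_left (word e x) (word e y), H.add_mem_cancel_right (hDH hxy)]

lemma uniformState_ne_zero (e : Fin q ≃ G) (H : AddSubgroup (Fin n → G)) :
    uniformState e H ≠ 0 := by
  intro h
  have : uniformState e H ((word e).symm 0) = 1 := uniformState_of_mem (by simp)
  rw [h] at this
  exact zero_ne_one this

lemma shiftOperator_uniformState {s : Fin n → G} (hs : s ∈ H) :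
    Matrix.toEuclideanLin (shiftOperator e s) (uniformState e H) = uniformState e H := by
  ext x
  rw [toEuclideanLin_shiftOperator_apply]
  refine uniformState_eq_of_mem_iff ?_
  rw [word_translate, H.add_mem_cancel_right hs]

lemma inner_shiftOperator_uniformState {s : Fin n → G} (hs : s ∉ H) :
    inner ℂ (uniformState e H) (Matrix.toEuclideanLin (shiftOperator e s) (uniformState e H)) =
      0 := by
  rw [PiLp.inner_apply]
  refine Finset.sum_eq_zero fun x _ => ?_
  rw [toEuclideanLin_shiftOperator_apply]
  by_cases hx : word e x ∈ H
  · have hxs : word e (translate e s x) ∉ H := by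
      rwa [word_translate, H.add_mem_cancel_left hx]
    rw [uniformState_of_notMem hxs, inner_zero_right]
  · rw [uniformState_of_notMem hx]
    exact inner_zero_left _

end UniformState

lemma eq_one_of_inner_shiftOperator (hDE : D ≤ E) {s : Fin n → G} (hs : s ∈ E) {c : ℂ}
    (hc : ∀ u ∈ cssCode e D E, ∀ v ∈ cssCode e D E,
      inner ℂ u (Matrix.toEuclideanLin (shiftOperator e s) v) = c * inner ℂ u v) : c = 1 := by
  have hE : uniformState e E ∈ cssCode e D E := uniformState_mem_cssCode hDE le_rfl
  have h := hc _ hE _ hE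
  rw [shiftOperator_uniformState hs] at h
  exact (mul_eq_right₀ (inner_self_ne_zero.2 (uniformState_ne_zero e E))).1 h.symm

lemma not_detects_shiftOperator (hDE : D ≤ E) {s : Fin n → G} (hs : s ∈ E) (hsD : s ∉ D) :
    ¬ Detects (cssCode e D E) (shiftOperator e s) := by
  rintro ⟨c, hc⟩
  have hD : uniformState e D ∈ cssCode e D E := uniformState_mem_cssCode le_rfl hDE
  have h := hc _ hD _ hD
  rw [inner_shiftOperator_uniformState hsD, eq_one_of_inner_shiftOperator hDE hs hc, one_mul] at h
  exact inner_self_ne_zero.2 (uniformState_ne_zero e D) h.symm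

lemma not_purelyDetects_shiftOperator (hDE : D ≤ E) {s : Fin n → G} (hs : s ∈ E) (hs0 : s ≠ 0) :
    ¬ PurelyDetects (cssCode e D E) (shiftOperator e s) := by
  intro h
  have := eq_one_of_inner_shiftOperator hDE hs h
  rw [trace_shiftOperator e hs0, zero_div] at this
  exact zero_ne_one this

end CSSCode

section DistanceTwo

variable {G : Type*} [AddCommGroup G] {n q : ℕ}

/-- The additive code of the words `(a₁ t, …, aₙ t)`: a repetition code twisted by automorphisms. -/
def twistedRepetition (a : Fin n → G ≃+ G) : AddSubgroup (Fin n → G) :=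
  (AddMonoidHom.pi fun i => (a i).toAddMonoidHom).range

lemma mem_twistedRepetition {a : Fin n → G ≃+ G} {v : Fin n → G} :
    v ∈ twistedRepetition a ↔ ∃ t, ∀ i, a i t = v i :=
  exists_congr fun _ => funext_iff

/-- The parity-check code of the words over `G` with sum zero. -/
def zeroSum (n : ℕ) (G : Type*) [AddCommGroup G] : AddSubgroup (Fin n → G) :=
  (∑ i, Pi.evalAddMonoidHom (fun _ => G) i).ker

lemma mem_zeroSum {v : Fin n → G} : v ∈ zeroSum n G ↔ ∑ i, v i = 0 := by
  simp [zeroSum, AddMonoidHom.mem_ker]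

lemma twistedRepetition_le_zeroSum {a : Fin n → G ≃+ G} (ha : ∀ t, ∑ i, a i t = 0) :
    twistedRepetition a ≤ zeroSum n G := by
  intro v hv
  obtain ⟨t, ht⟩ := mem_twistedRepetition.1 hv
  simpa only [mem_zeroSum, ht] using ha t

lemma disjoint_zeroSum_vanishingOn (i : Fin n) :
    Disjoint (zeroSum n G) (vanishingOn {i}ᶜ) := by
  refine AddSubgroup.disjoint_def.2 fun {v} hv hvi => funext fun j => ?_
  rcases eq_or_ne j i with rfl | hj
  · rw [mem_zeroSum, Fintype.sum_eq_single j fun k hk => hvi k hk] at hv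
    exact hv
  · exact hvi j hj

lemma codisjoint_twistedRepetition_vanishingOn (a : Fin n → G ≃+ G) (i : Fin n) :
    Codisjoint (twistedRepetition a) (vanishingOn {i}) := by
  refine codisjoint_iff.2 (eq_top_iff.2 fun v _ => AddSubgroup.mem_sup.2 ?_)
  let r : Fin n → G := fun j => a j ((a i).symm (v i))
  refine ⟨r, mem_twistedRepetition.2 ⟨_, fun _ => rfl⟩, v - r, ?_, add_sub_cancel r v⟩
  rintro _ rfl
  simp [r]

lemma card_twistedRepetition [NeZero n] (a : Fin n → G ≃+ G) :
    Nat.card (twistedRepetition a) = Nat.card G :=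
  Nat.card_congr (AddMonoidHom.ofInjective fun _ _ h =>
    (a 0).injective (congrFun h 0)).symm.toEquiv

lemma index_zeroSum (n : ℕ) [NeZero n] : (zeroSum n G).index = Nat.card G := by
  have sum_surjective :
      Function.Surjective (∑ i, Pi.evalAddMonoidHom (fun _ : Fin n => G) i : (Fin n → G) →+ G) :=
    fun g => ⟨Pi.single 0 g, by simp⟩
  rw [zeroSum, AddSubgroup.index_ker, AddMonoidHom.range_eq_top.2 sum_surjective,
    AddSubgroup.card_top]

lemma relIndex_twistedRepetition_zeroSum [Finite G] {a : Fin (n + 2) → G ≃+ G}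
    (ha : ∀ t, ∑ i, a i t = 0) :
    (twistedRepetition a).relIndex (zeroSum (n + 2) G) = Nat.card G ^ n := by
  have card_pos : 0 < Nat.card G := Nat.card_pos
  refine Nat.eq_of_mul_eq_mul_left card_pos (Nat.eq_of_mul_eq_mul_right card_pos ?_)
  calc Nat.card G * (twistedRepetition a).relIndex (zeroSum (n + 2) G) * Nat.card G
      = Nat.card (twistedRepetition a) * (twistedRepetition a).index := by
        rw [← AddSubgroup.relIndex_mul_index (twistedRepetition_le_zeroSum ha), index_zeroSum,
          card_twistedRepetition, mul_assoc]
    _ = Nat.card G ^ (n + 2) := by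
        rw [AddSubgroup.card_mul_index, Nat.card_fun, Nat.card_fin]
    _ = Nat.card G * Nat.card G ^ n * Nat.card G := by ring

lemma distanceAtLeast_two_cssCode [NeZero n] (e : Fin q ≃ G) (a : Fin n → G ≃+ G) :
    DistanceAtLeast (cssCode e (twistedRepetition a) (zeroSum n G)) 2 := by
  intro S A hS hA
  obtain ⟨i, hi⟩ := Finset.card_le_one_iff_subset_singleton.1 (Nat.le_of_lt_succ hS)
  have hi' : (S : Set (Fin n)) ⊆ {i} := by exact_mod_cast hi
  have pure := purelyDetects_cssCode (e := e) hA
    ((disjoint_zeroSum_vanishingOn i).mono_right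
      (vanishingOn_anti (Set.compl_subset_compl.2 hi')))
    ((codisjoint_twistedRepetition_vanishingOn a i).mono_right (vanishingOn_anti hi'))
  exact ⟨⟨_, pure⟩, fun _ => pure⟩

lemma not_distanceAtLeast_cssCode [Nontrivial G] (e : Fin q ≃ G) {a : Fin (n + 2) → G ≃+ G}
    (ha : ∀ t, ∑ i, a i t = 0) {d : ℕ} (hd : 2 < d) :
    ¬ DistanceAtLeast (cssCode e (twistedRepetition a) (zeroSum (n + 2) G)) d := by
  have : Finite G := Finite.of_equiv _ e
  have hDE := twistedRepetition_le_zeroSum ha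
  obtain ⟨g, hg⟩ := exists_ne (0 : G)
  let s : Fin (n + 2) → G := Pi.single 0 g - Pi.single 1 g
  have hs : s ∈ zeroSum (n + 2) G := by simp [mem_zeroSum, s]
  have hs0 : s ≠ 0 := fun h => hg (by simpa [s] using congrFun h 0)
  have s_local : s ∈ vanishingOn (({0, 1} : Finset (Fin (n + 2))) : Set (Fin (n + 2)))ᶜ := by
    intro i hi
    obtain ⟨hi0, hi1⟩ : i ≠ 0 ∧ i ≠ 1 := by simpa using hi
    simp [s, hi0, hi1]
  intro h
  obtain ⟨detects, pure⟩ := h {0, 1} (shiftOperator e s) (Finset.card_le_two.trans_lt hd)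
    (actsOnlyOn_shiftOperator e s_local)
  rcases n with _ | n
  · refine not_purelyDetects_shiftOperator hDE hs hs0 (pure ?_)
    rw [finrank_cssCode e hDE, relIndex_twistedRepetition_zeroSum ha, pow_zero]
  · refine not_detects_shiftOperator hDE hs (fun hsD => hg ?_) detects
    obtain ⟨t, ht⟩ := mem_twistedRepetition.1 hsD
    have s_last : s (Fin.last (n + 2)) = 0 := s_local _ (by simp [Fin.ext_iff])
    have ht0 : t = 0 := (a _).map_eq_zero_iff.1 ((ht _).trans s_last)
    simpa [s, ht0] using (ht 0).symm

lemma exists_isMDSCode_of_sum_eq_zero (hq : 1 < q) (hG : Nat.card G = q) (hn : 2 ≤ n)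
    (h : ∃ a : Fin n → G ≃+ G, ∀ t, ∑ i, a i t = 0) :
    ∃ C : Submodule ℂ (Qudits n q), IsMDSCode C (n - 2) 2 := by
  obtain ⟨m, rfl⟩ := Nat.exists_eq_add_of_le' hn
  obtain ⟨a, ha⟩ := h
  have : Finite G := Nat.finite_of_card_ne_zero (by lia)
  have : Nontrivial G := Finite.one_lt_card_iff_nontrivial.1 (by lia)
  let e : Fin q ≃ G := (Finite.equivFinOfCardEq hG).symm
  refine ⟨cssCode e (twistedRepetition a) (zeroSum (m + 2) G),
    ⟨?_, distanceAtLeast_two_cssCode e a, fun d hd => ?_⟩, by lia⟩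
  · rw [finrank_cssCode e (twistedRepetition_le_zeroSum ha),
      relIndex_twistedRepetition_zeroSum ha, hG, Nat.add_sub_cancel]
  · exact not_lt.1 fun hlt => not_distanceAtLeast_cssCode e ha hlt hd

end DistanceTwo

section VanishingSums

lemma exists_addEquiv_sum_eq_zero_of_even (G : Type*) [AddCommGroup G] {n : ℕ} (hn : Even n) :
    ∃ a : Fin n → G ≃+ G, ∀ t, ∑ i, a i t = 0 := by
  obtain ⟨k, rfl⟩ := hn
  exact ⟨Fin.append (fun _ => AddEquiv.refl G) fun _ => AddEquiv.neg G, fun t => by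
    simp only [Fin.sum_univ_add, Fin.append_left, Fin.append_right]
    simp⟩

lemma exists_addEquiv_sum_eq_zero {G : Type*} [AddCommGroup G] {φ ψ : G ≃+ G}
    (hψ : ∀ t, ψ t = t + φ t) {n : ℕ} (hn : 2 ≤ n) :
    ∃ a : Fin n → G ≃+ G, ∀ t, ∑ i, a i t = 0 := by
  rcases Nat.even_or_odd n with h_even | h_odd
  · exact exists_addEquiv_sum_eq_zero_of_even G h_even
  · obtain ⟨m, rfl⟩ : ∃ m, n = 3 + m := Nat.exists_eq_add_of_le (by grind)
    obtain ⟨b, hb⟩ := exists_addEquiv_sum_eq_zero_of_even G (n := m) (by grind)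
    refine ⟨Fin.append ![AddEquiv.refl G, φ, ψ.trans (AddEquiv.neg G)] b, fun t => ?_⟩
    simp [Fin.sum_univ_add, Fin.sum_univ_three, hb, hψ]

open Cardinal in
lemma exists_isUnit_one_add_of_three_le_card {K : Type*} [DivisionRing K] (hK : 3 ≤ #K) :
    ∃ u : K, IsUnit u ∧ IsUnit (1 + u) := by
  obtain ⟨u, hu, hu'⟩ := exists_ne_ne_of_three_le hK 0 (-1)
  have one_add_ne_zero : 1 + u ≠ 0 := fun h => hu' (eq_neg_of_add_eq_zero_right h)
  exact ⟨u, hu.isUnit, one_add_ne_zero.isUnit⟩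

lemma isUnit_one_add_one_zmod {m : ℕ} (hm : Odd m) : IsUnit (1 + 1 : ZMod m) := by
  rw [one_add_one_eq_two]
  exact_mod_cast (ZMod.isUnit_iff_coprime 2 m).2 (Nat.coprime_two_left.2 hm)

open Cardinal in
lemma exists_ring_isUnit_one_add {q : ℕ} (hq : q ≠ 0) (h : Odd q ∨ 4 ∣ q) :
    ∃ (R : Type) (_ : Ring R), Nat.card R = q ∧ ∃ u : R, IsUnit u ∧ IsUnit (1 + u) := by
  obtain ⟨k, m, hm, rfl⟩ := Nat.exists_eq_two_pow_mul_odd hq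
  have h_two := isUnit_one_add_one_zmod hm
  rcases Nat.eq_zero_or_pos k with rfl | hk
  · exact ⟨ZMod m, inferInstance, by simp, 1, isUnit_one, h_two⟩
  · have hk_two : 2 ≤ k := by
      have h_even : ¬ Odd (2 ^ k * m) :=
        Nat.not_odd_iff_even.2 ((even_two.pow_of_ne_zero hk.ne').mul_right m)
      have h_four : 2 ^ 2 ∣ 2 ^ k :=
        ((Nat.coprime_two_left.2 hm).pow_left 2).dvd_of_dvd_mul_right (h.resolve_left h_even)
      exact (Nat.pow_dvd_pow_iff_le_right Nat.one_lt_two).1 h_four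
    have card_field : Nat.card (GaloisField 2 k) = 2 ^ k := GaloisField.card 2 k hk.ne'
    have three_le : 3 ≤ #(GaloisField 2 k) := by
      rw [← Nat.cast_card, card_field]
      exact_mod_cast (by norm_num : 3 ≤ 2 ^ 2).trans (Nat.pow_le_pow_right two_pos hk_two)
    obtain ⟨w, hw, hw'⟩ := exists_isUnit_one_add_of_three_le_card three_le
    exact ⟨GaloisField 2 k × ZMod m, inferInstance, by simp [card_field], (w, 1),
      Prod.isUnit_iff.2 ⟨hw, isUnit_one⟩, Prod.isUnit_iff.2 ⟨hw', h_two⟩⟩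

lemma exists_addEquiv_sum_eq_zero_of_isUnit {R : Type*} [Ring R] {u : R} (hu : IsUnit u)
    (hu' : IsUnit (1 + u)) {n : ℕ} (hn : 2 ≤ n) :
    ∃ a : Fin n → R ≃+ R, ∀ t, ∑ i, a i t = 0 := by
  obtain ⟨u, rfl⟩ := hu
  obtain ⟨v, hv⟩ := hu'
  refine exists_addEquiv_sum_eq_zero (φ := DistribMulAction.toAddEquiv R u)
    (ψ := DistribMulAction.toAddEquiv R v) (fun t => ?_) hn
  simp [Units.smul_def, hv, add_mul]

end VanishingSums

end QuantumCode

theorem mainTheorem3 (q : ℕ) (hq : 1 < q) :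
    (∀ n : ℕ, 2 ≤ n → Even n →
      ∃ C : Submodule ℂ (QuantumCode.Qudits n q), QuantumCode.IsMDSCode C (n - 2) 2) ∧
    ((Odd q ∨ 4 ∣ q) → ∀ n : ℕ, 2 ≤ n →
      ∃ C : Submodule ℂ (QuantumCode.Qudits n q), QuantumCode.IsMDSCode C (n - 2) 2) := by
  refine ⟨fun n hn h_even => ?_, fun h n hn => ?_⟩
  · exact QuantumCode.exists_isMDSCode_of_sum_eq_zero hq (Nat.card_zmod q) hn
      (QuantumCode.exists_addEquiv_sum_eq_zero_of_even (ZMod q) h_even)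
  · obtain ⟨R, _, hR, u, hu, hu'⟩ := QuantumCode.exists_ring_isUnit_one_add (by lia) h
    exact QuantumCode.exists_isMDSCode_of_sum_eq_zero hq hR hn
      (QuantumCode.exists_addEquiv_sum_eq_zero_of_isUnit hu hu' hn)
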